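/- Let $G^s=(V,E)$, $E\subseteq V\times V$, be a finite directed graph with a distinguished node $s\in V$ (loops are allowed), given by a list of the successors of each node in an arbitrary order, and let $k\ge 0$ be an integer. A path is a finite nonempty sequence of nodes in which consecutive nodes are joined by an edge; it is simple if its nodes are distinct. A simple cycle is a path $(v_1,\dots,v_m)$ with $m\ge 2$ and $v_1=v_m$ such that $(v_1,\dots,v_{m-1})$ is a simple path; its length is its number $m-1$ of edges. Consider the following procedures, which act on a global stack of nodes, locks $Lock(v)\in\mathbb{N}\cup\{\infty\}$, and sets $Blist(v)\subseteq V$. $RELAX\_LOCKS(u)$: if $Lock(u)<\infty$, then set $Lock(u):=\infty$ and, for each $w\in Blist(u)$ (in an arbitrary order), if $w$ is not on the stack, call $RELAX\_LOCKS(w)$. $CYCLE\_SEARCH(G^s,v,k,flen)$: 1. Set $blen:=\infty$ and $Lock(v):=flen$, and push $v$ onto the stack. 2. For each successor $w$ of $v$: if $w=s$, output the cycle consisting of the nodes on the stack (from bottom to top) followed by $w$, and set $blen:=1$; otherwise, if $flen+1<Lock(w)$ and $flen+1<k$, set $blen:=\min(blen,\,1+CYCLE\_SEARCH(G^s,w,k,flen+1))$.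 3. If $blen<\infty$, call $RELAX\_LOCKS(v)$; otherwise, add $v$ to $Blist(w)$ for every successor $w$ of $v$. 4. Pop $v$ from the stack and return $blen$. Started with all locks equal to $\infty$, all Blists empty and an empty stack, the call $CYCLE\_SEARCH(G^s,s,k,0)$ terminates and outputs every simple cycle of $G^s$ of length at most $k$ that starts at $s$. -/

import Mathlib

/-- The data on which the bounded-length cycle search operates: the locks (a natural number
or `⊤` for infinity), the Blists, the search stack (bottom first, top last), and the list of
cycles output so far. -/
@[ext]
structure SearchState (V : Type*) where
  lock : V → ℕ∞
  blist : V → Finset V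
  stack : List V
  output : List (List V)

/-- The state before the search: all locks are infinite, all Blists and the stack are empty,
nothing has been output. -/
def SearchState.init (V : Type*) : SearchState V where
  lock := fun _ => ⊤
  blist := fun _ => ∅
  stack := []
  output := []

/-- A path in `G`: a finite nonempty sequence of nodes, consecutive ones joined by an edge. -/
def IsPath {V : Type*} (G : Digraph V) (p : List V) : Prop :=
  p ≠ [] ∧ p.IsChain G.Adj

/-- A simple path: all nodes are distinct. -/
def IsSimplePath {V : Type*} (G : Digraph V) (p : List V) : Prop :=
  IsPath G p ∧ p.Nodup

/-- A simple cycle `(v₁, …, vₘ)`: a path with `m ≥ 2` and `v₁ = vₘ` such that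
`(v₁, …, vₘ₋₁)` is a simple path. -/
def IsSimpleCycle {V : Type*} (G : Digraph V) (c : List V) : Prop :=
  2 ≤ c.length ∧ IsPath G c ∧ IsSimplePath G c.dropLast ∧ c.head? = c.getLast?

/-- The length of a path or cycle: its number of edges (the sequence is nonempty). -/
def pathLength {V : Type*} (p : List V) : ℕ := p.length - 1

/-- The modified `RELAX_LOCKS`: a finite lock of `u` is reset to infinity, and the procedure
recurses to the members of `Blist(u)` that are not on the stack. The members of `Blist(u)` are
visited in the order `order σ u`, where `σ` is the state in which the procedure is called.
(The bound `k` and the length `blen` no longer influence the procedure and are not passed.)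
The first argument bounds the depth of the recursion that is carried out; the result is `none`
if that bound is exceeded, and the result of the procedure otherwise. -/
def relaxLocks {V : Type*} [DecidableEq V] (order : SearchState V → V → List V) :
    ℕ → V → SearchState V → Option (SearchState V)
  | 0, _, _ => none
  | n + 1, u, σ =>
    if σ.lock u < ⊤ then
      (order σ u).foldlM
        (fun τ w => if w ∉ τ.stack then relaxLocks order n w τ else some τ)
        { σ with lock := Function.update σ.lock u ⊤ }
    else some σ

/-- Put `v` on the Blist of `w`. -/
def addToBlist {V : Type*} [DecidableEq V] (v : V) (σ : SearchState V) (w : V) :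
    SearchState V :=
  { σ with blist := Function.update σ.blist w (insert v (σ.blist w)) }

/-- `CYCLE_SEARCH` at node `v` with start node `s`, length bound `k`, and current depth `flen`.
`succ v` lists the successors of `v`. The result is the returned value `blen` together with the
final state. The first explicit natural number bounds the depth of the recursion that is carried
out; the result is `none` if that bound is exceeded (here or in `relaxLocks`), and the result of
the search otherwise. -/
noncomputable def cycleSearch {V : Type*} [DecidableEq V] (succ : V → List V)
    (order : SearchState V → V → List V) (s : V) (k : ℕ) :
    (n : ℕ) → (v : V) → (flen : ℕ) → SearchState V → Option (ℕ∞ × SearchState V)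
  | 0, _, _, _ => none
  | n + 1, v, flen, σ => do
    -- set the lock of `v`, push `v`, start with `blen = ∞`, and go through the successors
    let r ← (succ v).foldlM
      (fun (x : ℕ∞ × SearchState V) w =>
        if w = s then
          -- a cycle has been found: output it and set `blen` to 1
          some ((1 : ℕ∞), { x.2 with output := x.2.output ++ [x.2.stack ++ [w]] })
        else if ((flen + 1 : ℕ) : ℕ∞) < x.2.lock w ∧ flen + 1 < k then do
          let y ← cycleSearch succ order s k n w (flen + 1) x.2
          some (min x.1 (1 + y.1), y.2)
        else some x)
      ((⊤ : ℕ∞), { σ with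
        lock := Function.update σ.lock v (flen : ℕ∞)
        stack := σ.stack ++ [v] })
    -- relax the locks if a cycle has been found, otherwise put `v` on its successors' Blists
    let τ ← if r.1 < ⊤ then relaxLocks order n v r.2
      else some ((succ v).foldl (addToBlist v) r.2)
    -- pop `v` and return `blen`
    some (r.1, { τ with stack := τ.stack.dropLast })

/-! A lock may only block searches that cannot succeed. Under `LocksConsistent` with `P = ∅`, an
off-stack node with finite lock `f` has no edge to `s`, and its successors' locks are at most `f +
1` unless `k ≤ f + 1`. Going backwards along a short path that avoids the stack and closes at `s`,
starting from its last node, whose lock must be infinite, one finds that no node is locked at the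
depth where the path reaches it (`LocksConsistent.lt_lock`). So no short cycle is skipped. The
invariant survives relaxation because the Blist of an unlocked node contains every off-stack
predecessor with a finite lock (`relaxLocks_spec`). It survives popping a failed node because a
failed search leaves no lock higher than before (`cycleSearch_spec`). Termination: `k` bounds the
search depth, and each relaxation that recurses removes a finite lock. -/

/-- Invariant rule for a monadic fold in `Option`: if every step succeeds and maintains a
property of the visited prefix and the accumulator, then so does the whole fold. -/
theorem exists_foldlM_eq_some {α β : Type*} {f : β → α → Option β} (L : List α)
    (P : List α → β → Prop) {x : β} (h0 : P [] x)
    (hstep : ∀ l w y, w ∈ L → P l y → ∃ z, f y w = some z ∧ P (l ++ [w]) z) :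
    ∃ y, L.foldlM f x = some y ∧ P L y := by
  induction L using List.reverseRecOn with
  | nil => exact ⟨x, rfl, h0⟩
  | append_singleton L a ih =>
    obtain ⟨y, hy, hP⟩ := ih fun l w y hw => hstep l w y (by simp [hw])
    obtain ⟨z, hz, hP'⟩ := hstep L a y (by simp) hP
    exact ⟨z, by simp [List.foldlM_append, hy, hz], hP'⟩

theorem foldlM_eq_some_mono {α β : Type*} {f g : β → α → Option β}
    (h : ∀ x w y, f x w = some y → g x w = some y) (L : List α) {x y : β}
    (hf : L.foldlM f x = some y) : L.foldlM g x = some y := by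
  induction L generalizing x with
  | nil => exact hf
  | cons a L ih =>
    rw [List.foldlM_cons] at hf ⊢
    obtain ⟨z, hz, hzy⟩ := Option.bind_eq_some_iff.1 hf
    exact Option.bind_eq_some_iff.2 ⟨z, h _ _ _ hz, ih hzy⟩

/-! ### The lock invariant and continuations of the stack -/

/-- The locks of `σ` are consistent up to `P`: a node `u` off the stack with finite lock `f` does
not have `s` as a successor, is on the Blists of its successors, and the lock of each successor
outside `P` is at most `f + 1`, unless the length bound `k` prevents a search at depth `f + 1`. -/
def LocksConsistent {V : Type*} (succ : V → List V) (s : V) (k : ℕ) (P : Set V) (σ : SearchState V) : Prop :=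
  ∀ u ∉ σ.stack, ∀ f : ℕ, σ.lock u = f → s ∉ succ u ∧
    ∀ w ∈ succ u, u ∈ σ.blist w ∧ (w ∈ P ∨ σ.lock w ≤ (f + 1 : ℕ) ∨ k ≤ f + 1)

/-- The node list `p` continues the stack `S` to a simple cycle through `s` of length at most `k`:
it is a simple path disjoint from `S` whose last node has `s` as a successor, and `s` is not
among the nodes after the first. -/
def IsContinuation {V : Type*} (succ : V → List V) (s : V) (k : ℕ) (S p : List V) : Prop :=
  p.IsChain (fun x y => y ∈ succ x) ∧ p.Nodup ∧ (∀ x ∈ p, x ∉ S) ∧ s ∉ p.tail ∧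
    (∀ x ∈ p.getLast?, s ∈ succ x) ∧ S.length + p.length ≤ k

theorem IsContinuation.tail {V : Type*} {succ : V → List V} {s : V} {k : ℕ} {S q : List V} {v : V}
    (h : IsContinuation succ s k S (v :: q)) : IsContinuation succ s k (S ++ [v]) q := by
  obtain ⟨h1, h2, h3, h4, h5, h6⟩ := h
  refine ⟨h1.tail, h2.of_cons, fun x hx => ?_, fun hs => h4 (List.mem_of_mem_tail hs),
    fun x hx => h5 x ?_, ?_⟩
  · have hxv : x ≠ v := by
      rintro rfl
      exact (List.nodup_cons.1 h2).1 hx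
    simp [hxv, h3 x (List.mem_cons_of_mem _ hx)]
  · cases q with
    | nil => simp at hx
    | cons a q => simpa using hx
  · simp only [List.length_append, List.length_cons, List.length_nil] at h6 ⊢
    omega

/-- Under consistent locks, a node from which the stack can be continued to a short cycle is
not locked at a depth at which it would be reached. -/
theorem LocksConsistent.lt_lock {V : Type*} {succ : V → List V} {s : V} {k : ℕ} {σ : SearchState V}
    (h : LocksConsistent succ s k ∅ σ) {q : List V} {w : V} {m : ℕ}
    (hc : (w :: q).IsChain (fun x y => y ∈ succ x)) (hd : ∀ x ∈ w :: q, x ∉ σ.stack)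
    (hs : ∀ x ∈ (w :: q).getLast?, s ∈ succ x) (hk : m + (w :: q).length ≤ k) :
    (m : ℕ∞) < σ.lock w := by
  induction q generalizing w m with
  | nil =>
    by_contra hlt
    obtain ⟨f, hf⟩ := ENat.ne_top_iff_exists.1 (ne_top_of_le_ne_top (ENat.natCast_ne_top m)
      (not_lt.1 hlt))
    exact (h w (hd w (by simp)) f hf.symm).1 (hs w (by simp))
  | cons y q ih =>
    by_contra hlt
    obtain ⟨f, hf⟩ := ENat.ne_top_iff_exists.1 (ne_top_of_le_ne_top (ENat.natCast_ne_top m)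
      (not_lt.1 hlt))
    rw [not_lt, ← hf, Nat.cast_le] at hlt
    simp only [List.length_cons] at hk
    have hlock := ih (w := y) (m := m + 1) hc.tail (fun x hx => hd x (List.mem_cons_of_mem _ hx))
      (fun x hx => hs x (by simpa using hx)) (by simp only [List.length_cons]; omega)
    -- With `f ≤ m`, a lock of `y` at most `f + 1` contradicts `m + 1 < σ.lock y`, and `k ≤ f + 1`
    -- contradicts the length bound, as at least two nodes remain.
    rcases ((h w (hd w (by simp)) f hf.symm).2 y (List.isChain_cons_cons.1 hc).1).2 with
      h' | h' | h'
    · exact h'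
    · have := hlock.trans_le h'
      rw [Nat.cast_lt] at this
      omega
    · omega

/-! ### Unfolding the search; independence of the recursion bound -/

section

variable {V : Type*} [DecidableEq V]

/-- The effect of examining the successor `w` in `cycleSearch`, with recursion bound `n`. -/
noncomputable def searchStep (succ : V → List V) (order : SearchState V → V → List V)
    (s : V) (k n flen : ℕ) (x : ℕ∞ × SearchState V) (w : V) : Option (ℕ∞ × SearchState V) :=
  if w = s then
    some ((1 : ℕ∞), { x.2 with output := x.2.output ++ [x.2.stack ++ [w]] })
  else if ((flen + 1 : ℕ) : ℕ∞) < x.2.lock w ∧ flen + 1 < k then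
    (cycleSearch succ order s k n w (flen + 1) x.2).bind fun y =>
      some (min x.1 (1 + y.1), y.2)
  else some x

theorem cycleSearch_succ (succ : V → List V) (order : SearchState V → V → List V)
    (s : V) (k n : ℕ) (v : V) (flen : ℕ) (σ : SearchState V) :
    cycleSearch succ order s k (n + 1) v flen σ =
      ((succ v).foldlM (searchStep succ order s k n flen)
        ((⊤ : ℕ∞), { σ with
          lock := Function.update σ.lock v (flen : ℕ∞)
          stack := σ.stack ++ [v] })).bind fun r =>
      (if r.1 < ⊤ then relaxLocks order n v r.2
        else some ((succ v).foldl (addToBlist v) r.2)).bind fun τ =>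
      some (r.1, { τ with stack := τ.stack.dropLast }) := by
  rw [cycleSearch]
  congr 1
  funext r
  split_ifs <;> rfl

theorem relaxLocks_mono (order : SearchState V → V → List V) (n : ℕ) (u : V)
    (σ τ : SearchState V) (h : relaxLocks order n u σ = some τ) :
    relaxLocks order (n + 1) u σ = some τ := by
  induction n generalizing u σ τ with
  | zero => simp [relaxLocks] at h
  | succ n ih =>
    rw [relaxLocks] at h ⊢
    split_ifs at h ⊢ with hu
    · refine foldlM_eq_some_mono (fun x w y hxy => ?_) _ h
      split_ifs at hxy ⊢
      · exact hxy
      · exact ih _ _ _ hxy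
    · exact h

theorem cycleSearch_mono (succ : V → List V) (order : SearchState V → V → List V)
    (s : V) (k n : ℕ) (v : V) (flen : ℕ) (σ : SearchState V) (r : ℕ∞ × SearchState V)
    (h : cycleSearch succ order s k n v flen σ = some r) :
    cycleSearch succ order s k (n + 1) v flen σ = some r := by
  induction n generalizing v flen σ r with
  | zero => simp [cycleSearch] at h
  | succ n ih =>
    rw [cycleSearch_succ] at h ⊢
    obtain ⟨x, hx, h⟩ := Option.bind_eq_some_iff.1 h
    obtain ⟨τ, hτ, h⟩ := Option.bind_eq_some_iff.1 h
    refine Option.bind_eq_some_iff.2 ⟨x, foldlM_eq_some_mono (fun y w z hyz => ?_) _ hx,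
      Option.bind_eq_some_iff.2 ⟨τ, ?_, h⟩⟩
    · unfold searchStep at hyz ⊢
      split_ifs at hyz ⊢
      · exact hyz
      · obtain ⟨t, ht, hz⟩ := Option.bind_eq_some_iff.1 hyz
        exact Option.bind_eq_some_iff.2 ⟨t, ih _ _ _ _ ht, hz⟩
      · exact hyz
    · split_ifs at hτ ⊢
      · exact relaxLocks_mono _ _ _ _ _ hτ
      · exact hτ

/-! ### Relaxing locks -/

/-- Raising the lock of `u` can only break the bound that predecessors of `u` impose on it;
exempting `u` absorbs this. -/
theorem LocksConsistent.relock {succ : V → List V} {s : V} {k : ℕ} {P : Set V}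
    {σ : SearchState V} (h : LocksConsistent succ s k P σ) (u : V) :
    LocksConsistent succ s k (insert u P)
      { σ with lock := Function.update σ.lock u ⊤ } := by
  intro x hx f hf
  dsimp only at hx hf ⊢
  have hxu : x ≠ u := by
    rintro rfl
    simp at hf
  rw [Function.update_of_ne hxu] at hf
  obtain ⟨h1, h2⟩ := h x hx f hf
  refine ⟨h1, fun w hw => ⟨(h2 w hw).1, ?_⟩⟩
  by_cases hwu : w = u
  · exact Or.inl (Or.inl hwu)
  · rw [Function.update_of_ne hwu]
    exact (h2 w hw).2.imp_left Or.inr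

/-- The set `P` of exempt nodes is arbitrary because nested calls run while the callers' nodes are
still exempt. The number of finite locks bounds the recursion depth. -/
theorem relaxLocks_spec [Fintype V] (succ : V → List V) (order : SearchState V → V → List V)
    (horder : ∀ σ u w, w ∈ order σ u ↔ w ∈ σ.blist u) (s : V) (k n : ℕ) (u : V)
    (σ : SearchState V) (hn : (Finset.univ.filter fun x => σ.lock x < ⊤).card < n) :
    ∃ τ, relaxLocks order n u σ = some τ ∧
      τ.stack = σ.stack ∧ τ.blist = σ.blist ∧ τ.output = σ.output ∧
      (∀ x, τ.lock x = σ.lock x ∨ τ.lock x = ⊤) ∧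
      (∀ x ∈ σ.stack, x ≠ u → τ.lock x = σ.lock x) ∧ τ.lock u = ⊤ ∧
      ∀ P, LocksConsistent succ s k P σ → LocksConsistent succ s k P τ := by
  induction n generalizing u σ with
  | zero => omega
  | succ n ih =>
    rw [relaxLocks]
    split_ifs with hu
    · obtain ⟨τ, hτ, h1, h2, h3, h4, h5, h6, h7, h8⟩ := exists_foldlM_eq_some
        (f := fun (τ : SearchState V) w => if w ∉ τ.stack then relaxLocks order n w τ else some τ)
        (x := { σ with lock := Function.update σ.lock u ⊤ }) (order σ u)
        (fun l τ => τ.stack = σ.stack ∧ τ.blist = σ.blist ∧ τ.output = σ.output ∧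
          (∀ x, τ.lock x = σ.lock x ∨ τ.lock x = ⊤) ∧
          (∀ x ∈ σ.stack, x ≠ u → τ.lock x = σ.lock x) ∧ τ.lock u = ⊤ ∧
          (∀ w ∈ l, w ∈ σ.stack ∨ τ.lock w = ⊤) ∧
          ∀ P, LocksConsistent succ s k P σ → LocksConsistent succ s k (insert u P) τ)
        (by
          refine ⟨rfl, rfl, rfl, fun x => ?_, fun x _ hx => Function.update_of_ne hx _ _,
            Function.update_self _ _ _, by simp, fun P hP => hP.relock u⟩
          by_cases hx : x = u
          · exact Or.inr (by simp [hx])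
          · exact Or.inl (Function.update_of_ne hx _ _))
        (by
          rintro l w τ - ⟨h1, h2, h3, h4, h5, h6, h7, h8⟩
          by_cases hw : w ∈ τ.stack
          · refine ⟨τ, by simp [hw], h1, h2, h3, h4, h5, h6, fun x hx => ?_, h8⟩
            rcases List.mem_append.1 hx with hx | hx
            · exact h7 x hx
            · rw [List.mem_singleton.1 hx]
              exact Or.inl (h1 ▸ hw)
          · have hlt : (Finset.univ.filter fun x => τ.lock x < ⊤).card <
                (Finset.univ.filter fun x => σ.lock x < ⊤).card := by
              refine Finset.card_lt_card (Finset.ssubset_iff_of_subset ?_ |>.2 ⟨u, ?_, ?_⟩)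
              · intro x
                rcases h4 x with h | h <;> simp [h]
              · simpa using hu
              · simp [h6]
            obtain ⟨ρ, hρ, g1, g2, g3, g4, g5, g6, g7⟩ := ih w τ (by omega)
            have hup : ∀ x, τ.lock x = ⊤ → ρ.lock x = ⊤ := fun x hx =>
              (g4 x).elim (fun h => h.trans hx) id
            refine ⟨ρ, by simpa [hw] using hρ, g1.trans h1, g2.trans h2, g3.trans h3,
              fun x => ?_, fun x hx hxu => ?_, hup u h6, fun x hx => ?_,
              fun P hP => g7 _ (h8 P hP)⟩
            · rcases g4 x with h | h
              · rw [h]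
                exact h4 x
              · exact Or.inr h
            · rw [g5 x (h1 ▸ hx) (fun h => hw (h ▸ h1 ▸ hx)), h5 x hx hxu]
            · rcases List.mem_append.1 hx with hx | hx
              · exact (h7 x hx).imp_right (hup x)
              · rw [List.mem_singleton.1 hx]
                exact Or.inr g6)
      refine ⟨τ, hτ, h1, h2, h3, h4, h5, h6, fun P hP x hx f hf => ?_⟩
      obtain ⟨g1, g2⟩ := h8 P hP x hx f hf
      refine ⟨g1, fun w hw => ⟨(g2 w hw).1, ?_⟩⟩
      -- The exemption of `u` is vacuous by now: an off-stack predecessor with a finite lock would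
      -- be on `Blist(u)`, hence already unlocked by the loop.
      rcases (g2 w hw).2 with (rfl | h) | h
      · exfalso
        have hxb := (g2 w hw).1
        rw [h2] at hxb
        rcases h7 x ((horder _ _ _).2 hxb) with h | h
        · exact hx (h1 ▸ h)
        · simp [hf] at h
      · exact Or.inl h
      · exact Or.inr h
    · exact ⟨σ, rfl, rfl, rfl, rfl, fun _ => Or.inl rfl, fun _ _ _ => rfl,
        not_lt_top_iff.1 hu, fun _ h => h⟩

/-! ### Correctness of the search -/

theorem foldl_addToBlist (v : V) (L : List V) (σ : SearchState V) :
    (L.foldl (addToBlist v) σ).lock = σ.lock ∧ (L.foldl (addToBlist v) σ).stack = σ.stack ∧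
    (L.foldl (addToBlist v) σ).output = σ.output ∧
    (∀ w, σ.blist w ⊆ (L.foldl (addToBlist v) σ).blist w) ∧
    ∀ w ∈ L, v ∈ (L.foldl (addToBlist v) σ).blist w := by
  induction L generalizing σ with
  | nil => simp
  | cons a L ih =>
    obtain ⟨h1, h2, h3, h4, h5⟩ := ih (addToBlist v σ a)
    rw [List.foldl_cons]
    have hsub : ∀ w, σ.blist w ⊆ (addToBlist v σ a).blist w := by
      intro w
      by_cases hw : w = a
      · subst hw
        simp [addToBlist]
      · simp [addToBlist, hw]
    refine ⟨h1, h2, h3, fun w => (hsub w).trans (h4 w), fun w hw => ?_⟩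
    rcases List.mem_cons.1 hw with rfl | hw
    · exact h4 w (by simp [addToBlist])
    · exact h5 w hw

/-- The clause for `b = ⊤` keeps the bounds on successors examined earlier valid while later ones
are searched. In the bound on `n`, `k - flen` pays for nested searches and `Fintype.card V` for a
relaxation. -/
theorem cycleSearch_spec [Fintype V] (succ : V → List V) (order : SearchState V → V → List V)
    (horder : ∀ σ u w, w ∈ order σ u ↔ w ∈ σ.blist u) (s : V) (k n : ℕ) (v : V) (flen : ℕ)
    (σ : SearchState V) (hn : k - flen + Fintype.card V + 2 ≤ n) (hlen : σ.stack.length = flen)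
    (hv : (flen : ℕ∞) < σ.lock v) (hst : ∀ x ∈ σ.stack, σ.lock x ≤ flen)
    (hσ : LocksConsistent succ s k ∅ σ) :
    ∃ b τ, cycleSearch succ order s k n v flen σ = some (b, τ) ∧
      τ.stack = σ.stack ∧ σ.output ⊆ τ.output ∧ (∀ x ∈ σ.stack, τ.lock x = σ.lock x) ∧
      LocksConsistent succ s k ∅ τ ∧
      (b = ⊤ → τ.lock v = flen ∧ ∀ x, τ.lock x ≤ σ.lock x) ∧
      ∀ q, IsContinuation succ s k σ.stack (v :: q) → σ.stack ++ v :: q ++ [s] ∈ τ.output := by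
  induction n generalizing v flen σ with
  | zero => omega
  | succ n ih =>
    have hvst : v ∉ σ.stack := fun h => not_le_of_gt hv (hst v h)
    obtain ⟨⟨b, τ⟩, hτ, h1, h2, h3, h4, h5, h6, h7⟩ := exists_foldlM_eq_some
      (f := searchStep succ order s k n flen)
      (x := ((⊤ : ℕ∞), { σ with
          lock := Function.update σ.lock v (flen : ℕ∞)
          stack := σ.stack ++ [v] })) (succ v)
      (fun l x => x.2.stack = σ.stack ++ [v] ∧ σ.output ⊆ x.2.output ∧
        (∀ y ∈ σ.stack, x.2.lock y = σ.lock y) ∧ x.2.lock v = flen ∧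
        LocksConsistent succ s k ∅ x.2 ∧
        (x.1 = ⊤ → (∀ y, x.2.lock y ≤ σ.lock y) ∧ s ∉ l ∧
          ∀ w ∈ l, x.2.lock w ≤ (flen + 1 : ℕ) ∨ k ≤ flen + 1) ∧
        ∀ q, IsContinuation succ s k σ.stack (v :: q) →
          -- The head is the node following `v` on the cycle, which is `s` itself when `q` is empty.
          (q ++ [s]).head? ∈ l.map some → σ.stack ++ v :: q ++ [s] ∈ x.2.output)
      (by
        refine ⟨rfl, fun _ h => h, fun y hy => ?_, Function.update_self _ _ _, ?_, ?_, by simp⟩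
        · exact Function.update_of_ne (fun h => hvst (by rwa [h] at hy)) _ _
        · intro u hu f hf
          dsimp only at hu hf ⊢
          simp only [List.mem_append, List.mem_singleton, not_or] at hu
          rw [Function.update_of_ne hu.2] at hf
          obtain ⟨g1, g2⟩ := hσ u hu.1 f hf
          refine ⟨g1, fun w hw => ⟨(g2 w hw).1, ?_⟩⟩
          -- Pushing `v` only lowers its lock, so upper bounds on successors' locks persist.
          by_cases hwv : w = v
          · subst hwv
            rw [Function.update_self]
            exact (g2 w hw).2.imp_right (Or.imp_left hv.le.trans)
          · rw [Function.update_of_ne hwv]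
            exact (g2 w hw).2
        · refine fun _ => ⟨fun y => ?_, by simp, by simp⟩
          dsimp only
          by_cases hy : y = v
          · subst hy
            rw [Function.update_self]
            exact hv.le
          · rw [Function.update_of_ne hy])
      (by
        rintro l w ⟨b, τ⟩ - ⟨h1, h2, h3, h4, h5, h6, h7⟩
        dsimp only at h1 h2 h3 h4 h5 h6 h7
        unfold searchStep
        dsimp only
        split_ifs with hws hlk
        · subst hws
          refine ⟨_, rfl, h1, fun c hc => by simp [h2 hc], h3, h4, h5, by simp, ?_⟩
          intro q hq hl
          cases q with
          | nil => simp [h1]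
          | cons y q =>
            have hyw : y ≠ w := by
              rintro rfl
              exact hq.2.2.2.1 (by simp)
            have := h7 (y :: q) hq (by simpa [hyw] using hl)
            simp only [List.mem_append]
            exact Or.inl this
        · obtain ⟨b', ρ, hρ, g1, g2, g3, g4, g5, g6⟩ := ih w (flen + 1) τ (by omega)
            (by simp [h1, hlen]) hlk.1
            (by
              intro x hx
              rw [h1, List.mem_append, List.mem_singleton] at hx
              rcases hx with hx | rfl
              · rw [h3 x hx]
                exact (hst x hx).trans (by exact_mod_cast Nat.le_succ _)
              · rw [h4]
                exact_mod_cast Nat.le_succ _) h5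
          rw [hρ]
          refine ⟨_, rfl, g1.trans h1, fun c hc => g2 (h2 hc), fun y hy => ?_, ?_, g4, ?_, ?_⟩
          · exact (g3 y (by simp [h1, hy])).trans (h3 y hy)
          · exact (g3 v (by simp [h1])).trans h4
          · intro hb
            dsimp only at hb ⊢
            rw [min_eq_top, ENat.add_eq_top] at hb
            obtain ⟨e1, e2, e3⟩ := h6 hb.1
            obtain ⟨e4, e5⟩ := g5 (hb.2.resolve_left ENat.one_ne_top)
            refine ⟨fun y => (e5 y).trans (e1 y), ?_, fun y hy => ?_⟩
            · simp only [List.mem_append, List.mem_singleton, not_or]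
              exact ⟨e2, Ne.symm hws⟩
            · rcases List.mem_append.1 hy with hy | hy
              · exact (e3 y hy).imp_left (e5 y).trans
              · rw [List.mem_singleton.1 hy]
                exact Or.inl e4.le
          · intro q hq hl
            rw [List.map_append, List.mem_append] at hl
            rcases hl with hl | hl
            · exact g2 (h7 q hq hl)
            · cases q with
              | nil => exact absurd (by simpa using hl) (Ne.symm hws)
              | cons y q =>
                obtain rfl : y = w := by simpa using hl
                have := g6 q (h1 ▸ hq.tail)
                simpa [h1] using this
        · refine ⟨_, rfl, h1, h2, h3, h4, h5, fun hb => ?_, fun q hq hl => ?_⟩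
          · obtain ⟨e1, e2, e3⟩ := h6 hb
            refine ⟨e1, ?_, fun y hy => ?_⟩
            · simp only [List.mem_append, List.mem_singleton, not_or]
              exact ⟨e2, Ne.symm hws⟩
            · rcases List.mem_append.1 hy with hy | hy
              · exact e3 y hy
              · rw [List.mem_singleton.1 hy]
                rwa [not_and_or, not_lt, not_lt] at hlk
          · rw [List.map_append, List.mem_append] at hl
            rcases hl with hl | hl
            · exact h7 q hq hl
            · cases q with
              | nil => exact absurd (by simpa using hl) (Ne.symm hws)
              | cons y q =>
                obtain rfl : y = w := by simpa using hl
                -- A skipped successor starts no continuation: consistency and the length bound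
                -- would make both tests succeed.
                exfalso
                obtain ⟨c1, -, c3, -, c5, c6⟩ := hq.tail
                simp only [List.length_append, List.length_cons, List.length_nil, hlen] at c6
                refine hlk ⟨h5.lt_lock c1 (h1 ▸ c3) c5 ?_, ?_⟩
                · simp only [List.length_cons]
                  omega
                · omega)
    dsimp only at h1 h2 h3 h4 h5 h6 h7
    have hout : ∀ q, IsContinuation succ s k σ.stack (v :: q) →
        σ.stack ++ v :: q ++ [s] ∈ τ.output := by
      refine fun q hq => h7 q hq ?_
      rw [List.mem_map]
      cases q with
      | nil => exact ⟨s, hq.2.2.2.2.1 v (by simp), rfl⟩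
      | cons y q => exact ⟨y, (List.isChain_cons_cons.1 hq.1).1, rfl⟩
    rw [cycleSearch_succ, hτ, Option.bind_some]
    dsimp only
    split_ifs with hb
    · obtain ⟨ρ, hρ, g1, -, g3, g4, g5, g6, g7⟩ := relaxLocks_spec succ order horder s k n v τ
        (lt_of_le_of_lt (Finset.card_le_univ _) (by omega))
      rw [hρ]
      refine ⟨b, _, rfl, by simp [g1, h1], by rwa [g3], fun x hx => ?_, ?_,
        fun h => absurd h hb.ne, by rwa [g3]⟩
      · rw [← h3 x hx]
        exact g5 x (by simp [h1, hx]) (fun h => hvst (h ▸ hx))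
      · intro u hu f hf
        dsimp only at hu hf ⊢
        -- Popping `v` adds no new condition, since its lock is now infinite.
        have huv : u ≠ v := by
          rintro rfl
          simp [g6] at hf
        refine g7 _ h5 u ?_ f hf
        rw [g1, h1, List.dropLast_concat] at hu
        simp [g1, h1, hu, huv]
    · obtain ⟨g1, g2, g3, g4, g5⟩ := foldl_addToBlist v (succ v) τ
      obtain ⟨e1, e2, e3⟩ := h6 (not_lt_top_iff.1 hb)
      refine ⟨b, _, rfl, by simp [g2, h1], by rwa [g3], fun x hx => ?_, ?_, fun _ => ?_,
        by rwa [g3]⟩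
      · rw [← h3 x hx, g1]
      · intro u hu f hf
        dsimp only at hu hf ⊢
        rw [g2, h1, List.dropLast_concat] at hu
        rw [g1] at hf ⊢
        -- The popped node has lock `flen`; the loop invariant bounds its successors' locks and it
        -- has just joined their Blists.
        by_cases huv : u = v
        · subst huv
          rw [h4, Nat.cast_inj] at hf
          subst hf
          exact ⟨e2, fun w hw => ⟨g5 w hw, Or.inr (e3 w hw)⟩⟩
        · obtain ⟨a1, a2⟩ := h5 u (by simp [h1, hu, huv]) f hf
          exact ⟨a1, fun w hw => ⟨g4 w (a2 w hw).1, (a2 w hw).2⟩⟩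
      · rw [g1]
        exact ⟨h4, e1⟩

end

/-! ### Simple cycles as continuations of the empty stack -/

theorem lemma2 {V : Type*} [Fintype V] [DecidableEq V] (Gs : Digraph V)
    (succ : V → List V) (hsucc : ∀ v w, w ∈ succ v ↔ Gs.Adj v w)
    (order : SearchState V → V → List V)
    (horder : ∀ σ u w, w ∈ order σ u ↔ w ∈ σ.blist u)
    (s : V) (k : ℕ) :
    ∃ (blen : ℕ∞) (σ : SearchState V),
      (∃ N : ℕ, ∀ n ≥ N,
        cycleSearch succ order s k n s 0 (SearchState.init V) = some (blen, σ)) ∧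
      ∀ c : List V, IsSimpleCycle Gs c → c.head? = some s → pathLength c ≤ k →
        c ∈ σ.output := by
  obtain ⟨b, τ, hτ, -, -, -, -, -, hout⟩ := cycleSearch_spec succ order horder s k
    (k - 0 + Fintype.card V + 2) s 0 (SearchState.init V) le_rfl rfl
    (by simp [SearchState.init]) (by simp [SearchState.init])
    (fun u _ f hf => by simp [SearchState.init] at hf)
  refine ⟨b, τ, ⟨k - 0 + Fintype.card V + 2, fun n hn => ?_⟩, fun c hc hs hk => ?_⟩
  · induction n, hn using Nat.le_induction with
    | base => exact hτ
    | succ n _ ih => exact cycleSearch_mono _ _ _ _ _ _ _ _ _ ih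
  · obtain ⟨h2, ⟨-, hchain⟩, ⟨-, hnodup⟩, hlast⟩ := hc
    rw [hs] at hlast
    obtain ⟨p, rfl⟩ : ∃ p, c = p ++ [s] := by
      obtain ⟨p, hp⟩ := List.getLast?_eq_some_iff.1 hlast.symm
      exact ⟨p, hp⟩
    rw [List.dropLast_concat] at hnodup
    cases p with
    | nil => simp at h2
    | cons a q =>
      obtain rfl : a = s := by simpa using hs
      have hchain' := List.isChain_append.1 hchain
      refine hout q ⟨hchain'.1.imp fun x y h => (hsucc x y).2 h, hnodup, by simp [SearchState.init],
        (List.nodup_cons.1 hnodup).1, fun x hx => (hsucc _ _).2 (hchain'.2.2 x hx a (by simp)), ?_⟩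
      simpa [pathLength, SearchState.init] using hk
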